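/- Example 2 (Dirichlet energy: existence and uniqueness of the minimizer). Let $n\ge 1$ and let $\Omega\subset\mathbb{R}^n$ be open and bounded with $C^1$ boundary $\partial\Omega$ (that is, near every $p\in\partial\Omega$ the set $\Omega$ has the form $\{\rho<0\}$ for a $C^1$ function $\rho$ with $\nabla\rho(p)\neq 0$). Let $H^1(\Omega)=W^{1,2}(\Omega)$, with norm $\|v\|_{H^1}=\left(\int_\Omega v^2+\int_\Omega\|\nabla v\|^2\right)^{1/2}$, let $L^2(\partial\Omega)$ be taken with respect to surface measure, and let $\gamma_0:H^1(\Omega)\to L^2(\partial\Omega)$ be the trace operator, i.e. the continuous extension of the restriction map $\varphi\mapsto\varphi|_{\partial\Omega}$, $\varphi\in C^1(\overline\Omega)$; its graph is the closure in $H^1(\Omega)\times L^2(\partial\Omega)$ of the graph of this restriction map. Here $C^1(\overline\Omega)$ denotes the restrictions to $\overline\Omega$ of $C^1$ functions on $\mathbb{R}^n$. For $h\in L^2(\partial\Omega)$ put $$V'=\gamma_0^{-1}(h)=\{v\in H^1(\Omega):\gamma_0 v=h\},\qquad E(v)=\int_\Omega\|\nabla v\|^2\,dx .$$ Then: 1.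 $V'$ is a closed convex subset of $H^1(\Omega)$. 2. $E$ is continuous on $V'$, coercive on $V'$ (that is, $E(v)\to+\infty$ as $\|v\|_{H^1}\to\infty$ with $v\in V'$), and strictly convex on $V'$. 3. If $h$ is (almost everywhere on $\partial\Omega$) the restriction to $\partial\Omega$ of a function in $C^1(\overline\Omega)$, then $V'\neq\emptyset$. 4. If $V'\ne\emptyset$, then $E$ has exactly one minimizer $\bar v$ on $V'$. This $\bar v$ is a weak solution of Laplace's equation $\Delta\bar v=0$ in $\Omega$ with $\bar v=h$ on $\partial\Omega$, that is, $\gamma_0\bar v=h$ and $$\int_\Omega\nabla\bar v\cdot\nabla\varphi\,dx=0\qquad\text{for all }\varphi\in H^1_0(\Omega),$$ where $H^1_0(\Omega)$ is the closure of $C_c^\infty(\Omega)$ in $H^1(\Omega)$. -/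

import Mathlib

open MeasureTheory Set Filter Topology
open scoped ContDiff

noncomputable section

namespace DirichletProblem

/-- The Euclidean space of dimension `n`. -/
abbrev Euc (n : ℕ) := EuclideanSpace ℝ (Fin n)

/-- `Ω` has `C¹` boundary: near each of its boundary points `p`, the set `Ω` is the sublevel set
`{ρ < 0}` of a `C¹` function `ρ` whose derivative does not vanish at `p`. -/
def HasC1Boundary {n : ℕ} (Ω : Set (Euc n)) : Prop :=
  ∀ p ∈ frontier Ω, ∃ (U : Set (Euc n)) (ρ : Euc n → ℝ), IsOpen U ∧ p ∈ U ∧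
    ContDiffOn ℝ 1 ρ U ∧ fderiv ℝ ρ p ≠ 0 ∧ ∀ x ∈ U, (x ∈ Ω ↔ ρ x < 0)

/-- The surface measure of `∂Ω`: the `(n-1)`-dimensional Hausdorff measure, normalized so that it
agrees with Lebesgue measure on Euclidean spaces, restricted to the topological boundary. -/
def surfaceMeasure {n : ℕ} (Ω : Set (Euc n)) : Measure (Euc n) :=
  (Measure.euclideanHausdorffMeasure (n - 1)).restrict (frontier Ω)

/-- The space `L²(∂Ω)`. -/
abbrev L2Boundary {n : ℕ} (Ω : Set (Euc n)) : Type := Lp ℝ 2 (surfaceMeasure Ω)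

/-- The space `C_c^∞(Ω)` of test functions, extended by zero to the whole space. -/
def IsTestFunction {n : ℕ} (Ω : Set (Euc n)) (φ : Euc n → ℝ) : Prop :=
  ContDiff ℝ ∞ φ ∧ HasCompactSupport φ ∧ tsupport φ ⊆ Ω

/-- The vector field `G` is the weak gradient of `u` in `Ω`. -/
def IsWeakGradient {n : ℕ} (Ω : Set (Euc n)) (u : Euc n → ℝ) (G : Euc n → Euc n) : Prop :=
  ∀ φ : Euc n → ℝ, IsTestFunction Ω φ → ∀ i : Fin n,
    ∫ x in Ω, u x * fderiv ℝ φ x (EuclideanSpace.single i 1) = - ∫ x in Ω, G x i * φ x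

/-- The Hilbert space `L²(Ω) × L²(Ω; ℝⁿ)`, with norm `(‖u‖² + ‖G‖²)^{1/2}`. -/
abbrev L2Pair {n : ℕ} (Ω : Set (Euc n)) :=
  WithLp 2 (Lp ℝ 2 (volume.restrict Ω) × Lp (Euc n) 2 (volume.restrict Ω))

theorem integrable_mul_of_continuous {n : ℕ} {Ω : Set (Euc n)} {f ψ : Euc n → ℝ}
    (hf : MemLp f 2 (volume.restrict Ω)) (hψ : Continuous ψ) (hc : HasCompactSupport ψ) :
    Integrable (fun x => f x * ψ x) (volume.restrict Ω) :=
  MemLp.integrable_mul (q := 2) hf (hψ.memLp_of_hasCompactSupport hc)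

theorem integrable_mul_fderiv {n : ℕ} {Ω : Set (Euc n)} {φ : Euc n → ℝ}
    (hφ : IsTestFunction Ω φ) (u : Lp ℝ 2 (volume.restrict Ω)) (v : Euc n) :
    Integrable (fun x => u x * fderiv ℝ φ x v) (volume.restrict Ω) :=
  integrable_mul_of_continuous (Lp.memLp u)
    ((hφ.1.continuous_fderiv (by simp)).clm_apply continuous_const)
    (hφ.2.1.fderiv_apply (𝕜 := ℝ) v)

theorem integrable_coord_mul {n : ℕ} {Ω : Set (Euc n)} {φ : Euc n → ℝ}
    (hφ : IsTestFunction Ω φ) (G : Lp (Euc n) 2 (volume.restrict Ω)) (i : Fin n) :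
    Integrable (fun x => G x i * φ x) (volume.restrict Ω) :=
  integrable_mul_of_continuous
    ((EuclideanSpace.proj (𝕜 := ℝ) i).comp_memLp' (Lp.memLp G)) hφ.1.continuous hφ.2.1

/-- The Sobolev space `H¹(Ω)`: an element is a function `u ∈ L²(Ω)` that has a weak gradient in
`L²(Ω; ℝⁿ)`, stored as the pair of `u` and its (unique) weak gradient. The norm is
`(‖u‖² + ‖∇u‖²)^{1/2}`. -/
def H1 {n : ℕ} (Ω : Set (Euc n)) : Submodule ℝ (L2Pair Ω) where
  carrier := {p | IsWeakGradient Ω p.fst p.snd}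
  zero_mem' := by
    intro φ hφ i
    have h1 : ∫ x in Ω, (0 : Lp ℝ 2 (volume.restrict Ω)) x *
        fderiv ℝ φ x (EuclideanSpace.single i 1) = 0 := by
      rw [integral_eq_zero_of_ae]
      filter_upwards [Lp.coeFn_zero ℝ 2 (volume.restrict Ω)] with x hx
      rw [hx, Pi.zero_apply, zero_mul]
    have h2 : ∫ x in Ω, (0 : Lp (Euc n) 2 (volume.restrict Ω)) x i * φ x = 0 := by
      rw [integral_eq_zero_of_ae]
      filter_upwards [Lp.coeFn_zero (Euc n) 2 (volume.restrict Ω)] with x hx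
      rw [hx, Pi.zero_apply, PiLp.zero_apply, zero_mul, Pi.zero_apply]
    change ∫ x in Ω, (0 : Lp ℝ 2 (volume.restrict Ω)) x *
        fderiv ℝ φ x (EuclideanSpace.single i 1) =
      - ∫ x in Ω, (0 : Lp (Euc n) 2 (volume.restrict Ω)) x i * φ x
    rw [h1, h2, neg_zero]
  add_mem' := by
    intro p q hp hq φ hφ i
    have h1 : ∫ x in Ω, (p.fst + q.fst) x * fderiv ℝ φ x (EuclideanSpace.single i 1) =
        ∫ x in Ω, p.fst x * fderiv ℝ φ x (EuclideanSpace.single i 1) +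
          q.fst x * fderiv ℝ φ x (EuclideanSpace.single i 1) := by
      refine integral_congr_ae ?_
      filter_upwards [Lp.coeFn_add p.fst q.fst] with x hx
      rw [hx, Pi.add_apply, add_mul]
    have h2 : ∫ x in Ω, (p.snd + q.snd) x i * φ x =
        ∫ x in Ω, p.snd x i * φ x + q.snd x i * φ x := by
      refine integral_congr_ae ?_
      filter_upwards [Lp.coeFn_add p.snd q.snd] with x hx
      rw [hx, Pi.add_apply, PiLp.add_apply, add_mul]
    change ∫ x in Ω, (p.fst + q.fst) x * fderiv ℝ φ x (EuclideanSpace.single i 1) =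
      - ∫ x in Ω, (p.snd + q.snd) x i * φ x
    rw [h1, h2, integral_add (integrable_mul_fderiv hφ _ _) (integrable_mul_fderiv hφ _ _),
      integral_add (integrable_coord_mul hφ _ _) (integrable_coord_mul hφ _ _),
      hp φ hφ i, hq φ hφ i, neg_add]
  smul_mem' := by
    intro c p hp φ hφ i
    have h1 : ∫ x in Ω, (c • p.fst) x * fderiv ℝ φ x (EuclideanSpace.single i 1) =
        ∫ x in Ω, c * (p.fst x * fderiv ℝ φ x (EuclideanSpace.single i 1)) := by
      refine integral_congr_ae ?_
      filter_upwards [Lp.coeFn_smul c p.fst] with x hx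
      rw [hx, Pi.smul_apply, smul_eq_mul, mul_assoc]
    have h2 : ∫ x in Ω, (c • p.snd) x i * φ x = ∫ x in Ω, c * (p.snd x i * φ x) := by
      refine integral_congr_ae ?_
      filter_upwards [Lp.coeFn_smul c p.snd] with x hx
      rw [hx, Pi.smul_apply, PiLp.smul_apply, smul_eq_mul, mul_assoc]
    change ∫ x in Ω, (c • p.fst) x * fderiv ℝ φ x (EuclideanSpace.single i 1) =
      - ∫ x in Ω, (c • p.snd) x i * φ x
    rw [h1, h2, integral_const_mul, integral_const_mul, hp φ hφ i, mul_neg]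

/-- The function in `L²(Ω)` underlying an element of `H¹(Ω)`. -/
def H1.val {n : ℕ} {Ω : Set (Euc n)} (u : H1 Ω) : Lp ℝ 2 (volume.restrict Ω) :=
  (u : L2Pair Ω).fst

/-- The weak gradient of an element of `H¹(Ω)`. -/
def H1.grad {n : ℕ} {Ω : Set (Euc n)} (u : H1 Ω) : Lp (Euc n) 2 (volume.restrict Ω) :=
  (u : L2Pair Ω).snd

/-- `H¹₀(Ω)`: the closure of the test functions in `H¹(Ω)`. -/
def H10 {n : ℕ} (Ω : Set (Euc n)) : Set (H1 Ω) :=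
  closure {u | ∃ φ : Euc n → ℝ, IsTestFunction Ω φ ∧ H1.val u =ᵐ[volume.restrict Ω] φ}

/-- The graph of the trace operator `γ₀ : H¹(Ω) → L²(∂Ω)`, the continuous extension of the
restriction map `φ ↦ φ|_∂Ω`: it is the closure, in `H¹(Ω) × L²(∂Ω)`, of the graph of that
restriction map on the functions that are `C¹` up to the boundary (the restrictions to the closure
of `Ω` of `C¹` functions on the whole space). -/
def traceGraph {n : ℕ} (Ω : Set (Euc n)) : Set (H1 Ω × L2Boundary Ω) :=
  closure {p | ∃ φ : Euc n → ℝ, ContDiff ℝ 1 φ ∧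
    H1.val p.1 =ᵐ[volume.restrict Ω] φ ∧ p.2 =ᵐ[surfaceMeasure Ω] φ}

/-- The set `V' = γ₀⁻¹(h)` of the functions in `H¹(Ω)` whose trace on `∂Ω` is `h`. -/
def tracePreimage {n : ℕ} (Ω : Set (Euc n)) (h : L2Boundary Ω) : Set (H1 Ω) :=
  {u | (u, h) ∈ traceGraph Ω}

/-- The Dirichlet energy `∫_Ω ‖∇v‖²`. -/
def dirichletEnergy {n : ℕ} (Ω : Set (Euc n)) (v : H1 Ω) : ℝ :=
  ∫ x in Ω, ‖H1.grad v x‖ ^ 2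

/-- `v` is a weak solution of `Δv = 0` in `Ω`, `v = h` on `∂Ω`. -/
def IsWeakSolution {n : ℕ} (Ω : Set (Euc n)) (h : L2Boundary Ω) (v : H1 Ω) : Prop :=
  v ∈ tracePreimage Ω h ∧ ∀ φ ∈ H10 Ω, ∫ x in Ω, inner ℝ (H1.grad v x) (H1.grad φ x) = 0

end DirichletProblem

end

/-!
If nonempty, the set `V'` is a translate of the kernel `V₀` of the trace operator, and the
theorem rests on Poincaré's inequality `‖w‖ ≤ K ‖∇w‖` for `w ∈ V₀`. It makes `u ↦ ∇u` injective
on `V'` with a Lipschitz inverse. Hence `E(u) = ‖∇u‖²` is strictly convex and coercive on `V'`, and `∇V'` is a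
complete convex subset of `L²(Ω; ℝⁿ)`. The minimizer is given by the point of least norm of `∇V'`
(Hilbert's projection theorem); this point is orthogonal to `∇V₀`, and `V₀` contains `H¹₀(Ω)`, which
is the weak form of Laplace's equation. This Hilbert space argument is
`exists_isMinOn_norm_sq_of_norm_sub_le`.

Poincaré's inequality is obtained from Friedrichs' inequality
`∫_Ω φ² ≤ C (∫_∂Ω φ² + ∫_Ω ‖∇φ‖²)` for `φ ∈ C¹(Ω̄)`
(`lintegral_sq_le_surfaceMeasure_add_gradient`), which passes to the closure of the graph of the
restriction map. To apply it there, weak and classical gradients of a `C¹` function have to agree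
(`grad_ae_eq_gradient`).

Friedrichs' inequality is proved by following the ray from `x ∈ Ω` in direction `e₀` to the point
`y(x)` where it first leaves `Ω`. On that segment `φ(x)²` is controlled by `φ(y(x))²` and the
integral of `(∂₀φ)²`. Integrated over `x ∈ Ω`, the second term is bounded by Tonelli's theorem and
translation invariance. For the first term, `Ω` is cut into slices `{x₀ = s}`. On each slice `y` is a
section of the `1`-Lipschitz projection that drops the coordinate `x₀`, and Hausdorff measure does
not increase under this projection, so `y` carries Lebesgue measure of the slice to a measure
dominated by surface measure (`map_exitPoint_le_surfaceMeasure`).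
-/

namespace DirichletProblem

open scoped ENNReal NNReal

/-! ### The exit point of a ray -/

section ExitTime

variable {E : Type*} [NormedAddCommGroup E] [NormedSpace ℝ E] {Ω : Set E} {e : E} {R : ℝ}

/-- The first time `t ≥ 0` at which the ray `x + t e` is outside `Ω`. If the ray stays in `Ω`, which
does not happen for bounded `Ω` and `e ≠ 0`, the value is `0`. -/
noncomputable def exitTime (Ω : Set E) (e x : E) : ℝ := sInf {t : ℝ | 0 ≤ t ∧ x + t • e ∉ Ω}

/-- The point at which the ray from `x` in direction `e` leaves `Ω`. -/
noncomputable def exitPoint (Ω : Set E) (e x : E) : E := x + exitTime Ω e x • e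

theorem exists_add_smul_notMem (he : ‖e‖ = 1) (hR : Ω ⊆ Metric.ball 0 R) (x : E) :
    ∃ t : ℝ, 0 ≤ t ∧ x + t • e ∉ Ω := by
  refine ⟨‖x‖ + |R|, by positivity, fun h => ?_⟩
  have h1 : ‖x + (‖x‖ + |R|) • e‖ < R := by simpa using hR h
  have h2 : ‖(‖x‖ + |R|) • e‖ ≤ ‖x + (‖x‖ + |R|) • e‖ + ‖x‖ := by
    simpa using norm_sub_le (x + (‖x‖ + |R|) • e) x
  rw [norm_smul, he, mul_one, Real.norm_of_nonneg (by positivity)] at h2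
  linarith [le_abs_self R]

theorem exitTime_mem (hΩ : IsOpen Ω) (he : ‖e‖ = 1) (hR : Ω ⊆ Metric.ball 0 R) (x : E) :
    0 ≤ exitTime Ω e x ∧ exitPoint Ω e x ∉ Ω := by
  have hc : IsClosed {t : ℝ | 0 ≤ t ∧ x + t • e ∉ Ω} :=
    isClosed_Ici.inter (hΩ.isClosed_compl.preimage (by fun_prop : Continuous fun t : ℝ => x + t • e))
  exact hc.csInf_mem (exists_add_smul_notMem he hR x) ⟨0, fun t ht => ht.1⟩

theorem add_smul_mem_of_lt_exitTime {x : E} {t : ℝ} (h0 : 0 ≤ t) (ht : t < exitTime Ω e x) :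
    x + t • e ∈ Ω := by
  by_contra h
  exact notMem_of_lt_csInf ht ⟨0, fun t ht => ht.1⟩ ⟨h0, h⟩

theorem exitTime_le (he : ‖e‖ = 1) (hR : Ω ⊆ Metric.ball 0 R) {x : E} (hx : x ∈ Ω) :
    exitTime Ω e x ≤ 2 * R := by
  have hxR : ‖x‖ < R := by simpa using hR hx
  have h0 : 0 ≤ 2 * R := by linarith [norm_nonneg x]
  refine csInf_le ⟨0, fun t ht => ht.1⟩ ⟨h0, fun h => ?_⟩
  have h1 : ‖x + (2 * R) • e‖ < R := by simpa using hR h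
  have h2 : ‖(2 * R) • e‖ ≤ ‖x + (2 * R) • e‖ + ‖x‖ := by
    simpa using norm_sub_le (x + (2 * R) • e) x
  rw [norm_smul, he, mul_one, Real.norm_of_nonneg h0] at h2
  linarith

theorem exitPoint_mem_frontier (hΩ : IsOpen Ω) (he : ‖e‖ = 1) (hR : Ω ⊆ Metric.ball 0 R) {x : E}
    (hx : x ∈ Ω) : exitPoint Ω e x ∈ frontier Ω := by
  obtain ⟨h0, h1⟩ := exitTime_mem hΩ he hR x
  rw [hΩ.frontier_eq]
  refine ⟨?_, h1⟩
  have hpos : 0 < exitTime Ω e x := by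
    refine h0.lt_of_ne fun h => h1 ?_
    rwa [exitPoint, ← h, zero_smul, add_zero]
  have hlim : Tendsto (fun t : ℝ => x + t • e) (𝓝[<] exitTime Ω e x) (𝓝 (exitPoint Ω e x)) :=
    ((by fun_prop : Continuous fun t : ℝ => x + t • e).tendsto _).mono_left nhdsWithin_le_nhds
  refine mem_closure_of_tendsto hlim ?_
  filter_upwards [Ioo_mem_nhdsLT hpos] with t ht
  exact add_smul_mem_of_lt_exitTime ht.1.le ht.2

/-- The condition `a < exitTime Ω e x` says that the compact segment from `x` to `x + a e` lies in the
open set `Ω`, so it is open in `x`. -/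
theorem lowerSemicontinuous_exitTime (hΩ : IsOpen Ω) (he : ‖e‖ = 1)
    (hR : Ω ⊆ Metric.ball 0 R) : LowerSemicontinuous (exitTime Ω e) := by
  intro x a ha
  have h : ∀ᶠ x' in 𝓝 x, ∀ t ∈ Icc 0 a, x' + t • e ∈ Ω := by
    refine isCompact_Icc.eventually_forall_of_forall_eventually fun t ht => ?_
    have hc : Continuous fun p : E × ℝ => p.1 + p.2 • e := by fun_prop
    exact hc.continuousAt.eventually
      (hΩ.mem_nhds (add_smul_mem_of_lt_exitTime ht.1 (ht.2.trans_lt ha)))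
  filter_upwards [h] with x' hx'
  by_contra! hle
  obtain ⟨h0, h1⟩ := exitTime_mem hΩ he hR x'
  exact h1 (hx' _ ⟨h0, hle⟩)

theorem measurable_exitPoint [MeasurableSpace E] [BorelSpace E] [SecondCountableTopology E]
    (hΩ : IsOpen Ω) (he : ‖e‖ = 1) (hR : Ω ⊆ Metric.ball 0 R) : Measurable (exitPoint Ω e) :=
  measurable_id.add ((lowerSemicontinuous_exitTime hΩ he hR).measurable.smul_const e)

end ExitTime

/-! ### The boundary term on slices -/

section Slicing

variable {m : ℕ}

/-- The point of `ℝ^(m+1)` with first coordinate `p.1` and remaining coordinates `p.2`. -/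
noncomputable def euclideanCons (m : ℕ) (p : ℝ × Euc m) : Euc (m + 1) :=
  WithLp.toLp 2 (Fin.cons p.1 (WithLp.ofLp p.2) : Fin (m + 1) → ℝ)

/-- The projection of `ℝ^(m+1)` that drops the first coordinate. -/
noncomputable def euclideanTail (m : ℕ) (x : Euc (m + 1)) : Euc m :=
  WithLp.toLp 2 fun i => x i.succ

theorem measurePreserving_euclideanCons (m : ℕ) : MeasurePreserving (euclideanCons m) := by
  have h1 : MeasurePreserving (Prod.map id (WithLp.ofLp) : ℝ × Euc m → ℝ × (Fin m → ℝ)) :=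
    (MeasurePreserving.id volume).prod (PiLp.volume_preserving_ofLp (Fin m))
  have h2 := (volume_preserving_piFinSuccAbove (fun _ : Fin (m + 1) => ℝ) 0).symm
  have h3 := (PiLp.volume_preserving_toLp (Fin (m + 1))).comp (h2.comp h1)
  convert h3 using 1
  funext p
  change _ = WithLp.toLp 2 (Fin.insertNth (α := fun _ => ℝ) 0 p.1 (WithLp.ofLp p.2))
  rw [Fin.insertNth_zero']
  rfl

theorem lipschitzWith_euclideanTail : LipschitzWith 1 (euclideanTail m) := by
  refine LipschitzWith.of_dist_le_mul fun x y => ?_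
  rw [NNReal.coe_one, one_mul, EuclideanSpace.dist_eq, EuclideanSpace.dist_eq]
  refine Real.sqrt_le_sqrt ?_
  rw [Fin.sum_univ_succ (n := m)]
  exact le_add_of_nonneg_left (by positivity)

theorem euclideanHausdorffMeasure_image_le {X Y : Type*} [EMetricSpace X] [MeasurableSpace X]
    [BorelSpace X] [EMetricSpace Y] [MeasurableSpace Y] [BorelSpace Y] {f : X → Y}
    (hf : LipschitzWith 1 f) (d : ℕ) (s : Set X) :
    Measure.euclideanHausdorffMeasure d (f '' s) ≤ Measure.euclideanHausdorffMeasure d s := by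
  rw [Measure.euclideanHausdorffMeasure_def, Measure.euclideanHausdorffMeasure_def,
    Measure.smul_apply, Measure.smul_apply]
  gcongr
  simpa using hf.hausdorffMeasure_image_le d.cast_nonneg s

theorem euclideanTail_exitPoint_euclideanCons (Ω : Set (Euc (m + 1))) (p : ℝ × Euc m) :
    euclideanTail m (exitPoint Ω (EuclideanSpace.single 0 1) (euclideanCons m p)) = p.2 := by
  ext i
  simp [euclideanTail, exitPoint, euclideanCons]

variable {Ω : Set (Euc (m + 1))} {R : ℝ}

/-- On a slice `{x₀ = s}` of `Ω`, the exit point in direction `e₀` has the `1`-Lipschitz projection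
that drops `x₀` as a left inverse. So it pushes Lebesgue measure on the slice to a measure dominated
by surface measure. -/
theorem map_exitPoint_le_surfaceMeasure (hΩ : IsOpen Ω) (hR : Ω ⊆ Metric.ball 0 R) (s : ℝ) :
    ((volume : Measure (Euc m)).restrict ((fun x' => euclideanCons m (s, x')) ⁻¹' Ω)).map
      (fun x' => exitPoint Ω (EuclideanSpace.single 0 1) (euclideanCons m (s, x'))) ≤
    surfaceMeasure Ω := by
  have hcons : Measurable fun x' => euclideanCons m (s, x') :=
    (measurePreserving_euclideanCons m).measurable.comp measurable_prodMk_left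
  have hy : Measurable fun x' => exitPoint Ω (EuclideanSpace.single 0 1) (euclideanCons m (s, x')) :=
    (measurable_exitPoint hΩ (by simp) hR).comp hcons
  refine Measure.le_iff.2 fun A hA => ?_
  -- `surfaceMeasure Ω` is of dimension `m + 1 - 1`, which reduces to `m`
  rw [Measure.map_apply hy hA, Measure.restrict_apply (hy hA), surfaceMeasure,
    Measure.restrict_apply hA, ← EuclideanSpace.euclideanHausdorffMeasure_eq_volume]
  refine (measure_mono ?_).trans
    (euclideanHausdorffMeasure_image_le lipschitzWith_euclideanTail m (A ∩ frontier Ω))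
  rintro x' ⟨hx'A, hx'Ω⟩
  exact ⟨_, ⟨hx'A, exitPoint_mem_frontier hΩ (by simp) hR hx'Ω⟩,
    euclideanTail_exitPoint_euclideanCons Ω (s, x')⟩

/-- The bounds on the slices `{x₀ = s}`, integrated over `s`: only `|s| < R` contributes. -/
theorem lintegral_exitPoint_le (hΩ : IsOpen Ω) (hR : Ω ⊆ Metric.ball 0 R)
    {g : Euc (m + 1) → ℝ≥0∞} (hg : Measurable g) :
    ∫⁻ x in Ω, g (exitPoint Ω (EuclideanSpace.single 0 1) x) ≤
      ENNReal.ofReal (2 * R) * ∫⁻ y, g y ∂surfaceMeasure Ω := by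
  set y := exitPoint Ω (EuclideanSpace.single 0 1)
  have hym : Measurable y := measurable_exitPoint hΩ (by simp) hR
  have hcons := measurePreserving_euclideanCons m
  have hF : Measurable (Ω.indicator fun x => g (y x)) :=
    (hg.comp hym).indicator hΩ.measurableSet
  rw [← lintegral_indicator hΩ.measurableSet, ← hcons.lintegral_comp hF,
    Measure.volume_eq_prod,
    lintegral_prod (fun p => Ω.indicator (fun x => g (y x)) (euclideanCons m p))
      (hF.comp hcons.measurable).aemeasurable]
  have hslice : ∀ s : ℝ, ∫⁻ x', Ω.indicator (fun x => g (y x)) (euclideanCons m (s, x')) ≤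
      (Ioo (-R) R).indicator (fun _ => ∫⁻ y, g y ∂surfaceMeasure Ω) s := by
    intro s
    have hcs : Measurable fun x' => euclideanCons m (s, x') :=
      hcons.measurable.comp measurable_prodMk_left
    by_cases hs : s ∈ Ioo (-R) R
    · rw [indicator_of_mem hs]
      calc ∫⁻ x', Ω.indicator (fun x => g (y x)) (euclideanCons m (s, x'))
          = ∫⁻ x' in (fun x' => euclideanCons m (s, x')) ⁻¹' Ω,
              g (y (euclideanCons m (s, x'))) := by
            rw [← lintegral_indicator (hcs hΩ.measurableSet)]
            rfl
        _ = ∫⁻ z, g z ∂((volume : Measure (Euc m)).restrict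
              ((fun x' => euclideanCons m (s, x')) ⁻¹' Ω)).map
              (fun x' => y (euclideanCons m (s, x'))) :=
            (lintegral_map hg (hym.comp hcs)).symm
        _ ≤ ∫⁻ z, g z ∂surfaceMeasure Ω :=
            lintegral_mono' (map_exitPoint_le_surfaceMeasure hΩ hR s) le_rfl
    · refine (le_of_eq ?_).trans zero_le
      rw [← lintegral_zero (μ := (volume : Measure (Euc m)))]
      refine lintegral_congr fun x' => indicator_of_notMem (fun hx => hs ?_) _
      have h1 : ‖euclideanCons m (s, x')‖ < R := by simpa using hR hx
      have h2 := PiLp.norm_apply_le (euclideanCons m (s, x')) 0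
      exact abs_lt.1 (h2.trans_lt h1)
  refine (lintegral_mono hslice).trans ?_
  rw [lintegral_indicator measurableSet_Ioo, setLIntegral_const, Real.volume_Ioo, mul_comm]
  gcongr
  linarith

end Slicing

/-! ### Friedrichs' inequality for smooth functions -/

section Friedrichs

/-- The weight `exp t` absorbs the cross term of `(ψ²)' = 2ψψ'`: the derivative of `exp t * ψ²` is
at least `-exp t * ψ'²`. -/
theorem sq_le_exp_mul_add_integral_sq_deriv {ψ : ℝ → ℝ} (hψ : ContDiff ℝ 1 ψ) {τ : ℝ}
    (hτ : 0 ≤ τ) :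
    ψ 0 ^ 2 ≤ Real.exp τ * (ψ τ ^ 2 + ∫ t in (0 : ℝ)..τ, deriv ψ t ^ 2) := by
  have hd : Continuous (deriv ψ) := hψ.continuous_deriv le_rfl
  have hψc := hψ.continuous
  have hFTC : ∫ t in (0 : ℝ)..τ, Real.exp t * (ψ t ^ 2 + 2 * ψ t * deriv ψ t) =
      Real.exp τ * ψ τ ^ 2 - Real.exp 0 * ψ 0 ^ 2 := by
    refine intervalIntegral.integral_eq_sub_of_hasDerivAt (f := fun t => Real.exp t * ψ t ^ 2)
      (fun t _ => ?_)
      ((by fun_prop : Continuous fun t => Real.exp t * (ψ t ^ 2 + 2 * ψ t * deriv ψ t))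
        |>.intervalIntegrable _ _)
    have h1 := ((hψ.differentiable (by simp)) t).hasDerivAt
    exact ((Real.hasDerivAt_exp t).mul (h1.pow 2)).congr_deriv (by push_cast; simp; ring)
  have hle : ∫ t in (0 : ℝ)..τ, -(Real.exp τ * deriv ψ t ^ 2) ≤
      ∫ t in (0 : ℝ)..τ, Real.exp t * (ψ t ^ 2 + 2 * ψ t * deriv ψ t) := by
    refine intervalIntegral.integral_mono_on hτ
      ((by fun_prop : Continuous fun t => -(Real.exp τ * deriv ψ t ^ 2)).intervalIntegrable _ _)
      ((by fun_prop : Continuous fun t => Real.exp t * (ψ t ^ 2 + 2 * ψ t * deriv ψ t))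
        |>.intervalIntegrable _ _) fun t ht => ?_
    have h1 : Real.exp t * deriv ψ t ^ 2 ≤ Real.exp τ * deriv ψ t ^ 2 := by gcongr; exact ht.2
    have h2 : 0 ≤ Real.exp t * (ψ t + deriv ψ t) ^ 2 := by positivity
    linarith
  rw [intervalIntegral.integral_neg, intervalIntegral.integral_const_mul, hFTC] at hle
  simp only [Real.exp_zero, one_mul] at hle
  linarith

/-- Pointwise bound for `φ²` along the ray from `x`. The indicator of `Ω` extends the integral beyond
the exit time to a domain that does not depend on `x`, as Tonelli's theorem needs. -/
theorem sq_le_exitPoint_add_lintegral {E : Type*} [NormedAddCommGroup E] [NormedSpace ℝ E]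
    {Ω : Set E} {e : E} {R : ℝ} (hΩ : IsOpen Ω) (he : ‖e‖ = 1) (hR : Ω ⊆ Metric.ball 0 R)
    {φ : E → ℝ} (hφ : ContDiff ℝ 1 φ) {x : E} (hx : x ∈ Ω) :
    ‖φ x‖ₑ ^ 2 ≤ ENNReal.ofReal (Real.exp (2 * R)) * (‖φ (exitPoint Ω e x)‖ₑ ^ 2 +
      ∫⁻ t in Ioo 0 (2 * R), Ω.indicator (fun z => ‖fderiv ℝ φ z e‖ₑ ^ 2) (x + t • e)) := by
  obtain ⟨h0, -⟩ := exitTime_mem hΩ he hR x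
  set τ := exitTime Ω e x with hτ
  have hτR : τ ≤ 2 * R := exitTime_le he hR hx
  have hψ : ContDiff ℝ 1 fun t : ℝ => φ (x + t • e) := hφ.comp (by fun_prop)
  have hder : ∀ t : ℝ, deriv (fun t : ℝ => φ (x + t • e)) t = fderiv ℝ φ (x + t • e) e := by
    intro t
    have h1 : HasDerivAt (fun t : ℝ => x + t • e) e t := by
      simpa using ((hasDerivAt_id t).smul_const e).const_add x
    exact ((hφ.differentiable (by simp) _).hasFDerivAt.comp_hasDerivAt t h1).deriv
  have hc : Continuous fun t : ℝ => fderiv ℝ φ (x + t • e) e ^ 2 :=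
    (((hφ.continuous_fderiv (by simp)).comp (by fun_prop)).clm_apply continuous_const).pow 2
  have h1 := sq_le_exp_mul_add_integral_sq_deriv hψ h0
  simp only [hder, zero_smul, add_zero] at h1
  have henorm : ∀ a : ℝ, ‖a‖ₑ ^ 2 = ENNReal.ofReal (a ^ 2) := fun a => by
    rw [← ofReal_norm, ← ENNReal.ofReal_pow (norm_nonneg _), Real.norm_eq_abs, sq_abs]
  have h2 : ENNReal.ofReal (∫ t in (0 : ℝ)..τ, fderiv ℝ φ (x + t • e) e ^ 2) ≤
      ∫⁻ t in Ioo 0 (2 * R), Ω.indicator (fun z => ‖fderiv ℝ φ z e‖ₑ ^ 2) (x + t • e) := by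
    rw [intervalIntegral.integral_of_le h0, integral_Ioc_eq_integral_Ioo,
      ofReal_integral_eq_lintegral_ofReal
        ((hc.integrableOn_Icc (a := 0) (b := τ)).mono_set Ioo_subset_Icc_self)
        (ae_of_all _ fun t => sq_nonneg _)]
    calc ∫⁻ t in Ioo 0 τ, ENNReal.ofReal (fderiv ℝ φ (x + t • e) e ^ 2)
        = ∫⁻ t in Ioo 0 τ, Ω.indicator (fun z => ‖fderiv ℝ φ z e‖ₑ ^ 2) (x + t • e) := by
          refine setLIntegral_congr_fun measurableSet_Ioo fun t ht => ?_
          simp only [indicator_of_mem (add_smul_mem_of_lt_exitTime ht.1.le ht.2), henorm]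
      _ ≤ _ := lintegral_mono_set (Ioo_subset_Ioo_right hτR)
  calc ‖φ x‖ₑ ^ 2
      ≤ ENNReal.ofReal (Real.exp τ * (φ (exitPoint Ω e x) ^ 2 +
          ∫ t in (0 : ℝ)..τ, fderiv ℝ φ (x + t • e) e ^ 2)) := by
        rw [henorm]
        exact ENNReal.ofReal_le_ofReal h1
    _ = ENNReal.ofReal (Real.exp τ) * (‖φ (exitPoint Ω e x)‖ₑ ^ 2 +
          ENNReal.ofReal (∫ t in (0 : ℝ)..τ, fderiv ℝ φ (x + t • e) e ^ 2)) := by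
        rw [ENNReal.ofReal_mul (Real.exp_pos _).le, ENNReal.ofReal_add (sq_nonneg _)
          (intervalIntegral.integral_nonneg h0 fun t _ => sq_nonneg _), henorm]
    _ ≤ _ := by gcongr

/-- Friedrichs' inequality for functions that are `C¹` up to the boundary. -/
theorem lintegral_sq_le_surfaceMeasure_add_gradient {m : ℕ} {Ω : Set (Euc (m + 1))} {R : ℝ}
    (hΩ : IsOpen Ω) (hR : Ω ⊆ Metric.ball 0 R) {φ : Euc (m + 1) → ℝ} (hφ : ContDiff ℝ 1 φ) :
    ∫⁻ x in Ω, ‖φ x‖ₑ ^ 2 ≤ ENNReal.ofReal (Real.exp (2 * R)) * ENNReal.ofReal (2 * R) *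
      ((∫⁻ y, ‖φ y‖ₑ ^ 2 ∂surfaceMeasure Ω) + ∫⁻ x in Ω, ‖gradient φ x‖ₑ ^ 2) := by
  set e : Euc (m + 1) := EuclideanSpace.single 0 1
  have he : ‖e‖ = 1 := by simp [e]
  have hφm : Measurable fun y => ‖φ y‖ₑ ^ 2 := (hφ.continuous.enorm.measurable).pow_const 2
  have hdm : Measurable (Ω.indicator fun z => ‖fderiv ℝ φ z e‖ₑ ^ 2) :=
    ((((hφ.continuous_fderiv (by simp)).clm_apply continuous_const).enorm.measurable).pow_const
      2).indicator hΩ.measurableSet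
  have hym : Measurable (exitPoint Ω e) := measurable_exitPoint hΩ he hR
  have hgrad : ∫⁻ x in Ω, ∫⁻ t in Ioo 0 (2 * R),
      Ω.indicator (fun z => ‖fderiv ℝ φ z e‖ₑ ^ 2) (x + t • e) ≤
      ENNReal.ofReal (2 * R) * ∫⁻ x in Ω, ‖gradient φ x‖ₑ ^ 2 := by
    calc _ ≤ ∫⁻ x, ∫⁻ t in Ioo 0 (2 * R),
          Ω.indicator (fun z => ‖fderiv ℝ φ z e‖ₑ ^ 2) (x + t • e) := setLIntegral_le_lintegral _ _
      _ = ∫⁻ t in Ioo 0 (2 * R), ∫⁻ x,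
          Ω.indicator (fun z => ‖fderiv ℝ φ z e‖ₑ ^ 2) (x + t • e) :=
          lintegral_lintegral_swap (hdm.comp (by fun_prop)).aemeasurable
      _ = ENNReal.ofReal (2 * R) * ∫⁻ x in Ω, ‖fderiv ℝ φ x e‖ₑ ^ 2 := by
          simp_rw [lintegral_add_right_eq_self
            (Ω.indicator fun z => ‖fderiv ℝ φ z e‖ₑ ^ 2), lintegral_indicator hΩ.measurableSet]
          rw [setLIntegral_const, Real.volume_Ioo, sub_zero, mul_comm]
      _ ≤ _ := by
          gcongr with x
          rw [← inner_gradient_left, enorm_le_iff_norm_le]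
          simpa [he] using norm_inner_le_norm (𝕜 := ℝ) (gradient φ x) e
  calc ∫⁻ x in Ω, ‖φ x‖ₑ ^ 2
      ≤ ∫⁻ x in Ω, ENNReal.ofReal (Real.exp (2 * R)) * (‖φ (exitPoint Ω e x)‖ₑ ^ 2 +
          ∫⁻ t in Ioo 0 (2 * R), Ω.indicator (fun z => ‖fderiv ℝ φ z e‖ₑ ^ 2) (x + t • e)) :=
        setLIntegral_mono' hΩ.measurableSet fun x hx =>
          sq_le_exitPoint_add_lintegral hΩ he hR hφ hx
    _ = ENNReal.ofReal (Real.exp (2 * R)) * ((∫⁻ x in Ω, ‖φ (exitPoint Ω e x)‖ₑ ^ 2) +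
          ∫⁻ x in Ω, ∫⁻ t in Ioo 0 (2 * R),
            Ω.indicator (fun z => ‖fderiv ℝ φ z e‖ₑ ^ 2) (x + t • e)) := by
        rw [lintegral_const_mul' _ _ ENNReal.ofReal_ne_top,
          lintegral_add_left (by exact hφm.comp hym)]
    _ ≤ ENNReal.ofReal (Real.exp (2 * R)) *
          (ENNReal.ofReal (2 * R) * (∫⁻ y, ‖φ y‖ₑ ^ 2 ∂surfaceMeasure Ω) +
            ENNReal.ofReal (2 * R) * ∫⁻ x in Ω, ‖gradient φ x‖ₑ ^ 2) := by
        gcongr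
        exact lintegral_exitPoint_le hΩ hR hφm
    _ = _ := by ring

end Friedrichs

/-! ### The Sobolev space and weak gradients -/

section Sobolev

variable {n : ℕ} {Ω : Set (Euc n)}

theorem continuous_integral_inner {α F : Type*} [MeasurableSpace α] {μ : Measure α}
    [NormedAddCommGroup F] [InnerProductSpace ℝ F] {ψ : α → F} (hψ : MemLp ψ 2 μ) :
    Continuous fun f : Lp F 2 μ => ∫ x, inner ℝ (ψ x) (f x) ∂μ := by
  have h : (fun f : Lp F 2 μ => ∫ x, inner ℝ (ψ x) (f x) ∂μ) =
      fun f => inner ℝ (hψ.toLp ψ) f := by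
    funext f
    rw [L2.inner_def]
    refine integral_congr_ae ?_
    filter_upwards [hψ.coeFn_toLp] with x hx
    rw [hx]
  rw [h]
  fun_prop

theorem isClosed_H1 : IsClosed (H1 Ω : Set (L2Pair Ω)) := by
  have h : (H1 Ω : Set (L2Pair Ω)) = ⋂ (φ : Euc n → ℝ) (_ : IsTestFunction Ω φ) (i : Fin n),
      {p | ∫ x in Ω, p.fst x * fderiv ℝ φ x (EuclideanSpace.single i 1) =
        - ∫ x in Ω, p.snd x i * φ x} := by
    ext p
    simp only [mem_iInter]
    rfl
  rw [h]
  refine isClosed_iInter fun φ => isClosed_iInter fun hφ => isClosed_iInter fun i => ?_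
  have h1 : MemLp (fun x => fderiv ℝ φ x (EuclideanSpace.single i 1)) 2 (volume.restrict Ω) :=
    ((hφ.1.continuous_fderiv (by simp)).clm_apply continuous_const).memLp_of_hasCompactSupport
      (hφ.2.1.fderiv_apply (𝕜 := ℝ) _)
  have h2 : MemLp (fun x => φ x • (EuclideanSpace.single i 1 : Euc n)) 2 (volume.restrict Ω) :=
    (hφ.1.continuous.smul continuous_const).memLp_of_hasCompactSupport hφ.2.1.smul_right
  have h3 := (continuous_integral_inner h1).comp (WithLp.fstL 2 ℝ (Lp ℝ 2 (volume.restrict Ω))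
    (Lp (Euc n) 2 (volume.restrict Ω))).continuous
  have h4 := (continuous_integral_inner h2).comp (WithLp.sndL 2 ℝ (Lp ℝ 2 (volume.restrict Ω))
    (Lp (Euc n) 2 (volume.restrict Ω))).continuous
  refine isClosed_eq (h3.congr fun p => ?_) (h4.neg.congr fun p => ?_)
  · simp
  · simp [Function.comp_def, inner_smul_left, EuclideanSpace.inner_single_left, mul_comm]

instance completeSpace_H1 : CompleteSpace (H1 Ω) := isClosed_H1.completeSpace_coe

/-- The inclusion of `H¹(Ω)` into `L²(Ω)`. -/
noncomputable def valL (Ω : Set (Euc n)) : H1 Ω →L[ℝ] Lp ℝ 2 (volume.restrict Ω) :=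
  (WithLp.fstL 2 ℝ _ _).comp (H1 Ω).subtypeL

/-- The weak gradient as a continuous linear map on `H¹(Ω)`. -/
noncomputable def gradL (Ω : Set (Euc n)) : H1 Ω →L[ℝ] Lp (Euc n) 2 (volume.restrict Ω) :=
  (WithLp.sndL 2 ℝ _ _).comp (H1 Ω).subtypeL

theorem norm_sq_H1 (u : H1 Ω) : ‖u‖ ^ 2 = ‖valL Ω u‖ ^ 2 + ‖gradL Ω u‖ ^ 2 :=
  WithLp.prod_norm_sq_eq_of_L2 _

theorem dirichletEnergy_eq (u : H1 Ω) : dirichletEnergy Ω u = ‖gradL Ω u‖ ^ 2 := by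
  rw [← real_inner_self_eq_norm_sq, L2.inner_def]
  simp only [real_inner_self_eq_norm_sq]
  rfl

theorem continuous_gradient {φ : Euc n → ℝ} (hφ : ContDiff ℝ 1 φ) : Continuous (gradient φ) :=
  (InnerProductSpace.toDual ℝ (Euc n)).symm.continuous.comp (hφ.continuous_fderiv (by simp))

theorem gradient_apply (φ : Euc n → ℝ) (x : Euc n) (i : Fin n) :
    gradient φ x i = fderiv ℝ φ x (EuclideanSpace.single i 1) := by
  rw [← inner_gradient_left, EuclideanSpace.inner_single_right]
  simp

theorem IsTestFunction.setIntegral_mul_eq {ψ : Euc n → ℝ} (hψ : IsTestFunction Ω ψ)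
    (f : Euc n → ℝ) : ∫ x in Ω, f x * ψ x = ∫ x, f x * ψ x :=
  setIntegral_eq_integral_of_forall_compl_eq_zero fun x hx => by
    rw [image_eq_zero_of_notMem_tsupport fun h => hx (hψ.2.2 h), mul_zero]

theorem isWeakGradient_gradient {φ : Euc n → ℝ} (hφ : ContDiff ℝ 1 φ) :
    IsWeakGradient Ω φ (gradient φ) := by
  intro ψ hψ i
  have hψd : Continuous fun x => fderiv ℝ ψ x (EuclideanSpace.single i 1) :=
    (hψ.1.continuous_fderiv (by simp)).clm_apply continuous_const
  have hφd : Continuous fun x => fderiv ℝ φ x (EuclideanSpace.single i 1) :=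
    (hφ.continuous_fderiv (by simp)).clm_apply continuous_const
  have h1 : ∫ x in Ω, φ x * fderiv ℝ ψ x (EuclideanSpace.single i 1) =
      ∫ x, φ x * fderiv ℝ ψ x (EuclideanSpace.single i 1) :=
    setIntegral_eq_integral_of_forall_compl_eq_zero fun x hx => by
      rw [image_eq_zero_of_notMem_tsupport (f := fderiv ℝ ψ)
        fun h => hx (hψ.2.2 (tsupport_fderiv_subset ℝ h)), zero_apply, mul_zero]
  rw [h1, hψ.setIntegral_mul_eq]
  simp only [gradient_apply]
  exact integral_mul_fderiv_eq_neg_fderiv_mul_of_integrable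
    ((hφd.mul hψ.1.continuous).integrable_of_hasCompactSupport hψ.2.1.mul_left)
    ((hφ.continuous.mul hψd).integrable_of_hasCompactSupport
      (hψ.2.1.fderiv_apply (𝕜 := ℝ) _).mul_left)
    ((hφ.continuous.mul hψ.1.continuous).integrable_of_hasCompactSupport hψ.2.1.mul_left)
    (fun x _ => hφ.differentiable (by simp) x) (fun x _ => hψ.1.differentiable (by simp) x)

theorem memLp_restrict_of_continuous {F : Type*} [NormedAddCommGroup F] {f : Euc n → F}
    (hf : Continuous f) (hΩ : IsOpen Ω) (hb : Bornology.IsBounded Ω) :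
    MemLp f 2 (volume.restrict Ω) := by
  obtain ⟨C, hC⟩ := hb.isCompact_closure.exists_bound_of_continuousOn hf.continuousOn
  have : IsFiniteMeasure (volume.restrict Ω) := isFiniteMeasure_restrict.2 hb.measure_lt_top.ne
  refine MemLp.of_bound hf.aestronglyMeasurable C ?_
  filter_upwards [ae_restrict_mem hΩ.measurableSet] with x hx
  exact hC x (subset_closure hx)

/-- The restriction to `Ω` of a `C¹` function on `ℝⁿ`, as an element of `H¹(Ω)`. -/
theorem exists_H1_of_contDiff (hΩ : IsOpen Ω) (hb : Bornology.IsBounded Ω) {φ : Euc n → ℝ}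
    (hφ : ContDiff ℝ 1 φ) : ∃ u : H1 Ω, H1.val u =ᵐ[volume.restrict Ω] φ := by
  have h1 := memLp_restrict_of_continuous hφ.continuous hΩ hb
  have h2 := memLp_restrict_of_continuous (continuous_gradient hφ) hΩ hb
  refine ⟨⟨WithLp.toLp 2 (h1.toLp φ, h2.toLp (gradient φ)), fun ψ hψ i => ?_⟩, h1.coeFn_toLp⟩
  calc ∫ x in Ω, h1.toLp φ x * fderiv ℝ ψ x (EuclideanSpace.single i 1)
      = ∫ x in Ω, φ x * fderiv ℝ ψ x (EuclideanSpace.single i 1) := by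
        refine integral_congr_ae ?_
        filter_upwards [h1.coeFn_toLp] with x hx
        rw [hx]
    _ = - ∫ x in Ω, gradient φ x i * ψ x := isWeakGradient_gradient hφ ψ hψ i
    _ = - ∫ x in Ω, h2.toLp (gradient φ) x i * ψ x := by
        congr 1
        refine integral_congr_ae ?_
        filter_upwards [h2.coeFn_toLp] with x hx
        rw [hx]

/-- Weak gradients are unique: an element of `H¹(Ω)` that coincides with a `C¹` function has the
classical gradient of that function as its weak gradient. -/
theorem grad_ae_eq_gradient (hΩ : IsOpen Ω) (hb : Bornology.IsBounded Ω) {φ : Euc n → ℝ}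
    (hφ : ContDiff ℝ 1 φ) {u : H1 Ω} (hu : H1.val u =ᵐ[volume.restrict Ω] φ) :
    H1.grad u =ᵐ[volume.restrict Ω] gradient φ := by
  have : IsFiniteMeasure (volume.restrict Ω) := isFiniteMeasure_restrict.2 hb.measure_lt_top.ne
  have hi : ∀ i : Fin n, ∀ᵐ x ∂volume.restrict Ω, H1.grad u x i - gradient φ x i = 0 := by
    intro i
    have hL : MemLp (fun x => H1.grad u x i) 2 (volume.restrict Ω) :=
      (EuclideanSpace.proj (𝕜 := ℝ) i).comp_memLp' (Lp.memLp (H1.grad u))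
    have hφi : Continuous fun x => gradient φ x i :=
      (EuclideanSpace.proj (𝕜 := ℝ) i).continuous.comp (continuous_gradient hφ)
    rw [ae_restrict_iff' hΩ.measurableSet]
    have hloc : LocallyIntegrableOn (fun x => H1.grad u x i - gradient φ x i) Ω volume := by
      refine IntegrableOn.locallyIntegrableOn ?_
      exact (hL.sub (memLp_restrict_of_continuous hφi hΩ hb)).integrable (by norm_num)
    refine hΩ.ae_eq_zero_of_integral_contDiff_smul_eq_zero hloc fun ψ h1 h2 h3 => ?_
    have hψ : IsTestFunction Ω ψ := ⟨h1, h2, h3⟩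
    have hweak : ∫ x in Ω, H1.grad u x i * ψ x = ∫ x in Ω, gradient φ x i * ψ x := by
      rw [← neg_inj, ← isWeakGradient_gradient hφ ψ hψ i]
      refine (u.2 ψ hψ i).symm.trans (integral_congr_ae ?_)
      filter_upwards [hu] with x hx
      exact congrArg (· * _) hx
    calc ∫ x, ψ x • (H1.grad u x i - gradient φ x i)
        = ∫ x, (H1.grad u x i - gradient φ x i) * ψ x := by simp only [smul_eq_mul, mul_comm]
      _ = ∫ x in Ω, (H1.grad u x i - gradient φ x i) * ψ x := (hψ.setIntegral_mul_eq _).symm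
      _ = (∫ x in Ω, H1.grad u x i * ψ x) - ∫ x in Ω, gradient φ x i * ψ x := by
          simp only [sub_mul]
          exact integral_sub (integrable_mul_of_continuous hL h1.continuous h2)
            (integrable_mul_of_continuous (memLp_restrict_of_continuous hφi hΩ hb)
              h1.continuous h2)
      _ = 0 := by rw [hweak, sub_self]
  filter_upwards [ae_all_iff.2 hi] with x hx
  ext i
  exact sub_eq_zero.1 (hx i)

end Sobolev

/-! ### The trace -/

section Trace

variable {n : ℕ} {Ω : Set (Euc n)}

/-- The graph of the restriction map `φ ↦ φ|_∂Ω` on `C¹(Ω̄)`, as a subspace of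
`H¹(Ω) × L²(∂Ω)`. -/
noncomputable def restrictionGraph (Ω : Set (Euc n)) : Submodule ℝ (H1 Ω × L2Boundary Ω) where
  carrier := {p | ∃ φ : Euc n → ℝ, ContDiff ℝ 1 φ ∧
    H1.val p.1 =ᵐ[volume.restrict Ω] φ ∧ p.2 =ᵐ[surfaceMeasure Ω] φ}
  zero_mem' := by
    refine ⟨0, contDiff_const, ?_, ?_⟩
    · exact Lp.coeFn_zero ℝ 2 (volume.restrict Ω)
    · exact Lp.coeFn_zero ℝ 2 (surfaceMeasure Ω)
  add_mem' := by
    rintro p q ⟨φ, h1, h2, h3⟩ ⟨ψ, k1, k2, k3⟩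
    refine ⟨φ + ψ, h1.add k1, ?_, ?_⟩
    · exact (Lp.coeFn_add (H1.val p.1) (H1.val q.1)).trans (h2.add k2)
    · exact (Lp.coeFn_add p.2 q.2).trans (h3.add k3)
  smul_mem' := by
    rintro c p ⟨φ, h1, h2, h3⟩
    refine ⟨c • φ, h1.const_smul c, ?_, ?_⟩
    · exact (Lp.coeFn_smul c (H1.val p.1)).trans (h2.const_smul c)
    · exact (Lp.coeFn_smul c p.2).trans (h3.const_smul c)

theorem sub_mem_tracePreimage_zero {h : L2Boundary Ω} {u v : H1 Ω} (hu : u ∈ tracePreimage Ω h)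
    (hv : v ∈ tracePreimage Ω h) : u - v ∈ tracePreimage Ω 0 := by
  have := (restrictionGraph Ω).topologicalClosure.sub_mem hu hv
  rwa [Prod.mk_sub_mk, sub_self] at this

theorem add_mem_tracePreimage {h : L2Boundary Ω} {u w : H1 Ω} (hu : u ∈ tracePreimage Ω h)
    (hw : w ∈ tracePreimage Ω 0) : u + w ∈ tracePreimage Ω h := by
  have := (restrictionGraph Ω).topologicalClosure.add_mem hu hw
  rwa [Prod.mk_add_mk, add_zero] at this

theorem sub_mem_tracePreimage {h : L2Boundary Ω} {u w : H1 Ω} (hu : u ∈ tracePreimage Ω h)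
    (hw : w ∈ tracePreimage Ω 0) : u - w ∈ tracePreimage Ω h := by
  have := (restrictionGraph Ω).topologicalClosure.sub_mem hu hw
  rwa [Prod.mk_sub_mk, sub_zero] at this

theorem isClosed_tracePreimage (h : L2Boundary Ω) : IsClosed (tracePreimage Ω h) :=
  isClosed_closure.preimage (by fun_prop : Continuous fun u : H1 Ω => (u, h))

theorem _root_.Submodule.convex_setOf_prodMk_mem {X Y : Type*} [AddCommGroup X] [Module ℝ X]
    [AddCommGroup Y] [Module ℝ Y] (S : Submodule ℝ (X × Y)) (y : Y) :
    Convex ℝ {x | (x, y) ∈ S} := by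
  intro u hu v hv a b ha hb hab
  have := S.add_mem (S.smul_mem a hu) (S.smul_mem b hv)
  rwa [Prod.smul_mk, Prod.smul_mk, Prod.mk_add_mk, ← add_smul, hab, one_smul] at this

theorem convex_tracePreimage (h : L2Boundary Ω) : Convex ℝ (tracePreimage Ω h) :=
  (restrictionGraph Ω).topologicalClosure.convex_setOf_prodMk_mem h

theorem tracePreimage_nonempty (hΩ : IsOpen Ω) (hb : Bornology.IsBounded Ω) {h : L2Boundary Ω}
    {φ : Euc n → ℝ} (hφ : ContDiff ℝ 1 φ) (hh : h =ᵐ[surfaceMeasure Ω] φ) :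
    (tracePreimage Ω h).Nonempty := by
  obtain ⟨u, hu⟩ := exists_H1_of_contDiff hΩ hb hφ
  exact ⟨u, subset_closure ⟨φ, hφ, hu, hh⟩⟩

/-- Functions in `H¹₀(Ω)` have zero trace: test functions are supported in the open set `Ω`, so
they vanish on `∂Ω`. -/
theorem H10_subset_tracePreimage_zero (hΩ : IsOpen Ω) : H10 Ω ⊆ tracePreimage Ω 0 := by
  refine closure_minimal ?_ (isClosed_tracePreimage 0)
  rintro u ⟨φ, hφ, hu⟩
  refine subset_closure ⟨φ, hφ.1.of_le (by simp), hu, ?_⟩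
  refine (Lp.coeFn_zero ℝ 2 (surfaceMeasure Ω)).trans ?_
  filter_upwards [ae_restrict_mem isClosed_frontier.measurableSet] with x hx
  rw [hΩ.frontier_eq] at hx
  rw [image_eq_zero_of_notMem_tsupport fun h => hx.2 (hφ.2.2 h), Pi.zero_apply]

end Trace

/-! ### Poincaré's inequality for functions of zero trace -/

section Poincare

theorem enorm_sq_eq_lintegral_of_ae_eq {α F : Type*} [MeasurableSpace α] {μ : Measure α}
    [NormedAddCommGroup F] {f : Lp F 2 μ} {φ : α → F} (hf : f =ᵐ[μ] φ) :
    ‖f‖ₑ ^ 2 = ∫⁻ x, ‖φ x‖ₑ ^ 2 ∂μ := by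
  have := eLpNorm_nnreal_pow_eq_lintegral (f := φ) (μ := μ) (p := 2) two_ne_zero
  simp only [NNReal.coe_ofNat, ENNReal.rpow_ofNat] at this
  rw [Lp.enorm_def, eLpNorm_congr_ae hf]
  exact this

theorem norm_sq_le_of_enorm_sq_le {X Y Z : Type*} [NormedAddCommGroup X] [NormedAddCommGroup Y]
    [NormedAddCommGroup Z] {x : X} {y : Y} {z : Z} {a b : ℝ} (ha : 0 ≤ a) (hb : 0 ≤ b)
    (h : ‖x‖ₑ ^ 2 ≤ ENNReal.ofReal a * ENNReal.ofReal b * (‖y‖ₑ ^ 2 + ‖z‖ₑ ^ 2)) :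
    ‖x‖ ^ 2 ≤ a * b * (‖y‖ ^ 2 + ‖z‖ ^ 2) := by
  simp only [← ofReal_norm, ← ENNReal.ofReal_pow (norm_nonneg _)] at h
  rwa [← ENNReal.ofReal_add (sq_nonneg _) (sq_nonneg _), ← ENNReal.ofReal_mul ha,
    ← ENNReal.ofReal_mul (mul_nonneg ha hb), ENNReal.ofReal_le_ofReal_iff (by positivity)] at h

variable {n : ℕ} {Ω : Set (Euc n)}

theorem norm_sq_valL_le_of_contDiff {m : ℕ} {Ω : Set (Euc (m + 1))} {R : ℝ} (hΩ : IsOpen Ω)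
    (hR0 : 0 < R) (hR : Ω ⊆ Metric.ball 0 R) {φ : Euc (m + 1) → ℝ} (hφ : ContDiff ℝ 1 φ)
    {u : H1 Ω} {g : L2Boundary Ω} (hu : H1.val u =ᵐ[volume.restrict Ω] φ)
    (hg : g =ᵐ[surfaceMeasure Ω] φ) :
    ‖valL Ω u‖ ^ 2 ≤ Real.exp (2 * R) * (2 * R) * (‖g‖ ^ 2 + ‖gradL Ω u‖ ^ 2) := by
  have hgrad := grad_ae_eq_gradient hΩ (Metric.isBounded_ball.subset hR) hφ hu
  refine norm_sq_le_of_enorm_sq_le (Real.exp_pos _).le (by positivity) ?_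
  have e1 : ‖valL Ω u‖ₑ ^ 2 = ∫⁻ x in Ω, ‖φ x‖ₑ ^ 2 := enorm_sq_eq_lintegral_of_ae_eq hu
  have e3 : ‖gradL Ω u‖ₑ ^ 2 = ∫⁻ x in Ω, ‖gradient φ x‖ₑ ^ 2 :=
    enorm_sq_eq_lintegral_of_ae_eq hgrad
  rw [e1, enorm_sq_eq_lintegral_of_ae_eq hg, e3]
  exact lintegral_sq_le_surfaceMeasure_add_gradient hΩ hR hφ

/-- Friedrichs' inequality on the graph of the trace operator. -/
theorem exists_norm_sq_le_of_mem_traceGraph (hn : 1 ≤ n) (hΩ : IsOpen Ω)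
    (hb : Bornology.IsBounded Ω) : ∃ C : ℝ, 0 ≤ C ∧ ∀ p ∈ traceGraph Ω,
      ‖valL Ω p.1‖ ^ 2 ≤ C * (‖p.2‖ ^ 2 + ‖gradL Ω p.1‖ ^ 2) := by
  obtain ⟨m, rfl⟩ : ∃ m, n = m + 1 := ⟨n - 1, by omega⟩
  obtain ⟨R, hR0, hR⟩ := hb.subset_ball_lt 0 0
  refine ⟨Real.exp (2 * R) * (2 * R), by positivity, fun p hp => ?_⟩
  have hval : Continuous fun p : H1 Ω × L2Boundary Ω => ‖valL Ω p.1‖ :=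
    ((valL Ω).continuous.comp continuous_fst).norm
  have hgrad : Continuous fun p : H1 Ω × L2Boundary Ω => ‖gradL Ω p.1‖ :=
    ((gradL Ω).continuous.comp continuous_fst).norm
  refine le_on_closure ?_ (hval.pow 2).continuousOn
    (continuous_const.mul ((continuous_snd.norm.pow 2).add (hgrad.pow 2))).continuousOn hp
  rintro q ⟨φ, hφ, h1, h2⟩
  exact norm_sq_valL_le_of_contDiff hΩ hR0 hR hφ h1 h2

/-- Poincaré's inequality on the kernel of the trace operator. -/
theorem exists_norm_le_gradL (hn : 1 ≤ n) (hΩ : IsOpen Ω) (hb : Bornology.IsBounded Ω) :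
    ∃ K : ℝ≥0, 0 < K ∧ ∀ w ∈ tracePreimage Ω 0, ‖w‖ ≤ K * ‖gradL Ω w‖ := by
  obtain ⟨C, hC0, hC⟩ := exists_norm_sq_le_of_mem_traceGraph hn hΩ hb
  refine ⟨(√(C + 1)).toNNReal, Real.toNNReal_pos.2 (Real.sqrt_pos.2 (by linarith)), fun w hw => ?_⟩
  have h1 := hC _ hw
  rw [norm_zero] at h1
  rw [Real.coe_toNNReal _ (Real.sqrt_nonneg _),
    ← sq_le_sq₀ (norm_nonneg _) (mul_nonneg (Real.sqrt_nonneg _) (norm_nonneg _)), norm_sq_H1,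
    mul_pow, Real.sq_sqrt (by linarith)]
  linarith

theorem exists_norm_sub_le_gradL (hn : 1 ≤ n) (hΩ : IsOpen Ω) (hb : Bornology.IsBounded Ω)
    (h : L2Boundary Ω) : ∃ K : ℝ≥0, 0 < K ∧ ∀ u ∈ tracePreimage Ω h, ∀ v ∈ tracePreimage Ω h,
      ‖u - v‖ ≤ K * ‖gradL Ω u - gradL Ω v‖ := by
  obtain ⟨K, hK0, hK⟩ := exists_norm_le_gradL hn hΩ hb
  refine ⟨K, hK0, fun u hu v hv => ?_⟩
  rw [← map_sub]
  exact hK _ (sub_mem_tracePreimage_zero hu hv)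

end Poincare

/-! ### Minimizing a quadratic energy over a convex set -/

section QuadraticEnergy

variable {X Y : Type*} [NormedAddCommGroup X] [NormedSpace ℝ X] [NormedAddCommGroup Y]
  [InnerProductSpace ℝ Y] {G : X →L[ℝ] Y} {V : Set X} {K : ℝ≥0}

theorem tendsto_norm_sq_of_norm_sub_le (hK0 : 0 < K)
    (hK : ∀ u ∈ V, ∀ v ∈ V, ‖u - v‖ ≤ K * ‖G u - G v‖) :
    Tendsto (fun u => ‖G u‖ ^ 2) (Bornology.cobounded X ⊓ 𝓟 V) atTop := by
  obtain rfl | ⟨u₀, hu₀⟩ := V.eq_empty_or_nonempty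
  · rw [principal_empty, inf_bot_eq]
    exact tendsto_bot
  have hK0' : (0 : ℝ) < K := hK0
  refine (tendsto_pow_atTop two_ne_zero).comp ?_
  have hlim : Tendsto (fun u : X => (K : ℝ)⁻¹ * (‖u‖ - ‖u₀‖) - ‖G u₀‖)
      (Bornology.cobounded X ⊓ 𝓟 V) atTop := by
    refine tendsto_atTop_add_const_right _ _ (Tendsto.const_mul_atTop (inv_pos.2 hK0') ?_)
    exact tendsto_atTop_add_const_right _ _ (tendsto_norm_cobounded_atTop.mono_left inf_le_left)
  refine tendsto_atTop_mono' _ ?_ hlim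
  filter_upwards [mem_inf_of_right (mem_principal_self _)] with u hu
  have h1 : (K : ℝ)⁻¹ * (‖u‖ - ‖u₀‖) ≤ ‖G u - G u₀‖ := by
    rw [inv_mul_le_iff₀ hK0']
    exact (norm_sub_norm_le u u₀).trans (hK u hu u₀ hu₀)
  linarith [norm_sub_le (G u) (G u₀)]

theorem strictConvexOn_norm_sq_of_injOn (hV : Convex ℝ V) (hG : InjOn G V) :
    StrictConvexOn ℝ V fun u => ‖G u‖ ^ 2 := by
  refine ⟨hV, fun u hu v hv huv a b ha hb hab => ?_⟩
  have hpos : 0 < ‖G u - G v‖ := norm_pos_iff.2 (sub_ne_zero.2 fun h => huv (hG hu hv h))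
  simp only [map_add, map_smul, smul_eq_mul]
  -- the convexity gap of `‖·‖²` is `a * b * ‖G u - G v‖²`
  have hgap : ‖a • G u + b • G v‖ ^ 2 + a * b * ‖G u - G v‖ ^ 2 =
      a * ‖G u‖ ^ 2 + b * ‖G v‖ ^ 2 := by
    rw [norm_add_sq_real, norm_sub_sq_real, norm_smul, norm_smul, Real.norm_of_nonneg ha.le,
      Real.norm_of_nonneg hb.le, real_inner_smul_left, real_inner_smul_right]
    obtain rfl : b = 1 - a := by linarith
    ring
  have : 0 < a * b * ‖G u - G v‖ ^ 2 := by positivity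
  linarith

/-- The image `G '' V` is complete, so it has a point of least norm. That point is orthogonal to
all directions in which `V` can be left both ways. -/
theorem exists_isMinOn_norm_sq_of_norm_sub_le [CompleteSpace X] (hne : V.Nonempty)
    (hcl : IsClosed V) (hV : Convex ℝ V) (hK : ∀ u ∈ V, ∀ v ∈ V, ‖u - v‖ ≤ K * ‖G u - G v‖) :
    ∃ v ∈ V, IsMinOn (fun u => ‖G u‖ ^ 2) V v ∧
      ∀ w, v + w ∈ V → v - w ∈ V → inner ℝ (G v) (G w) = 0 := by
  have hcomp : IsComplete (G '' V) := by
    have : CompleteSpace V := hcl.completeSpace_coe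
    have hanti : AntilipschitzWith K fun u : V => G u := by
      refine AntilipschitzWith.of_le_mul_dist fun u v => ?_
      rw [Subtype.dist_eq, dist_eq_norm, dist_eq_norm]
      exact hK u u.2 v v.2
    rw [image_eq_range]
    exact hanti.isComplete_range (G.uniformContinuous.comp uniformContinuous_subtype_val)
  have hconv : Convex ℝ (G '' V) := hV.linear_image G.toLinearMap
  obtain ⟨_, ⟨v, hv, rfl⟩, hmin⟩ :=
    exists_norm_eq_iInf_of_complete_convex (hne.image G) hcomp hconv 0
  refine ⟨v, hv, fun w hw => ?_, fun w hw hw' => ?_⟩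
  · have h1 : ‖0 - G v‖ ≤ ‖0 - G w‖ := by
      rw [hmin]
      exact ciInf_le (f := fun y : G '' V => ‖0 - (y : Y)‖)
        ⟨0, by rintro _ ⟨y, rfl⟩; exact norm_nonneg _⟩ ⟨G w, w, hw, rfl⟩
    rw [zero_sub, zero_sub, norm_neg, norm_neg] at h1
    simp only [mem_ofPred_eq]
    gcongr
  · have hle := (norm_eq_iInf_iff_real_inner_le_zero hconv (mem_image_of_mem _ hv)).1 hmin
    have h1 := hle _ (mem_image_of_mem _ hw)
    have h2 := hle _ (mem_image_of_mem _ hw')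
    rw [map_add, add_sub_cancel_left, zero_sub, inner_neg_left] at h1
    rw [map_sub, sub_sub_cancel_left, zero_sub, inner_neg_neg] at h2
    linarith

end QuadraticEnergy

/-! ### The Dirichlet energy -/

section Energy

variable {n : ℕ} {Ω : Set (Euc n)}

theorem continuous_dirichletEnergy : Continuous (dirichletEnergy Ω) := by
  rw [funext dirichletEnergy_eq]
  exact (gradL Ω).continuous.norm.pow 2

theorem tendsto_dirichletEnergy (hn : 1 ≤ n) (hΩ : IsOpen Ω) (hb : Bornology.IsBounded Ω)
    (h : L2Boundary Ω) :
    Tendsto (dirichletEnergy Ω) (Bornology.cobounded (H1 Ω) ⊓ 𝓟 (tracePreimage Ω h)) atTop := by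
  obtain ⟨K, hK0, hK⟩ := exists_norm_sub_le_gradL hn hΩ hb h
  rw [funext dirichletEnergy_eq]
  exact tendsto_norm_sq_of_norm_sub_le hK0 hK

theorem strictConvexOn_dirichletEnergy (hn : 1 ≤ n) (hΩ : IsOpen Ω) (hb : Bornology.IsBounded Ω)
    (h : L2Boundary Ω) : StrictConvexOn ℝ (tracePreimage Ω h) (dirichletEnergy Ω) := by
  obtain ⟨K, -, hK⟩ := exists_norm_sub_le_gradL hn hΩ hb h
  rw [funext dirichletEnergy_eq]
  refine strictConvexOn_norm_sq_of_injOn (convex_tracePreimage h) fun u hu v hv huv => ?_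
  have h1 := hK u hu v hv
  rw [huv, sub_self, norm_zero, mul_zero] at h1
  exact sub_eq_zero.1 (norm_le_zero_iff.1 h1)

/-- Dirichlet's principle: an energy minimizer exists, and its gradient is orthogonal to the
gradients of all functions with zero trace. -/
theorem exists_isMinOn_dirichletEnergy (hn : 1 ≤ n) (hΩ : IsOpen Ω) (hb : Bornology.IsBounded Ω)
    {h : L2Boundary Ω} (hne : (tracePreimage Ω h).Nonempty) :
    ∃ v ∈ tracePreimage Ω h, IsMinOn (dirichletEnergy Ω) (tracePreimage Ω h) v ∧
      ∀ w ∈ tracePreimage Ω 0, inner ℝ (gradL Ω v) (gradL Ω w) = 0 := by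
  obtain ⟨K, -, hK⟩ := exists_norm_sub_le_gradL hn hΩ hb h
  obtain ⟨v, hv, hmin, horth⟩ := exists_isMinOn_norm_sq_of_norm_sub_le hne
    (isClosed_tracePreimage h) (convex_tracePreimage h) hK
  rw [funext dirichletEnergy_eq]
  refine ⟨v, hv, hmin, fun w hw => horth w (add_mem_tracePreimage hv hw) ?_⟩
  exact sub_mem_tracePreimage hv hw

end Energy

end DirichletProblem

theorem mainTheorem3 (n : ℕ) (hn : 1 ≤ n) (Ω : Set (EuclideanSpace ℝ (Fin n)))
    (hΩ : IsOpen Ω) (hb : Bornology.IsBounded Ω) (hC1 : DirichletProblem.HasC1Boundary Ω)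
    (h : DirichletProblem.L2Boundary Ω) :
    IsClosed (DirichletProblem.tracePreimage Ω h) ∧
    Convex ℝ (DirichletProblem.tracePreimage Ω h) ∧
    ContinuousOn (DirichletProblem.dirichletEnergy Ω) (DirichletProblem.tracePreimage Ω h) ∧
    Tendsto (DirichletProblem.dirichletEnergy Ω)
      (Bornology.cobounded (DirichletProblem.H1 Ω) ⊓ 𝓟 (DirichletProblem.tracePreimage Ω h))
      atTop ∧
    StrictConvexOn ℝ (DirichletProblem.tracePreimage Ω h) (DirichletProblem.dirichletEnergy Ω) ∧
    ((∃ φ : EuclideanSpace ℝ (Fin n) → ℝ, ContDiff ℝ 1 φ ∧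
        h =ᵐ[DirichletProblem.surfaceMeasure Ω] φ) →
      (DirichletProblem.tracePreimage Ω h).Nonempty) ∧
    ((DirichletProblem.tracePreimage Ω h).Nonempty →
      ∃ v ∈ DirichletProblem.tracePreimage Ω h,
        IsMinOn (DirichletProblem.dirichletEnergy Ω) (DirichletProblem.tracePreimage Ω h) v ∧
        (∀ w ∈ DirichletProblem.tracePreimage Ω h,
          IsMinOn (DirichletProblem.dirichletEnergy Ω) (DirichletProblem.tracePreimage Ω h) w →
            w = v) ∧
        DirichletProblem.IsWeakSolution Ω h v) := by
  refine ⟨DirichletProblem.isClosed_tracePreimage h, DirichletProblem.convex_tracePreimage h,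
    DirichletProblem.continuous_dirichletEnergy.continuousOn,
    DirichletProblem.tendsto_dirichletEnergy hn hΩ hb h,
    DirichletProblem.strictConvexOn_dirichletEnergy hn hΩ hb h,
    fun ⟨φ, hφ, hh⟩ => DirichletProblem.tracePreimage_nonempty hΩ hb hφ hh, fun hne => ?_⟩
  obtain ⟨v, hv, hmin, horth⟩ := DirichletProblem.exists_isMinOn_dirichletEnergy hn hΩ hb hne
  refine ⟨v, hv, hmin, fun w hw hwmin =>
    (DirichletProblem.strictConvexOn_dirichletEnergy hn hΩ hb h).eq_of_isMinOn hwmin hmin hw hv,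
    hv, fun φ hφ => ?_⟩
  have h0 := horth φ (DirichletProblem.H10_subset_tracePreimage_zero hΩ hφ)
  rwa [L2.inner_def] at h0
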